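/- For an $n\times n$ real symmetric matrix $M$, let $M_i$ denote the matrix obtained by deleting the $i$-th row and the $i$-th column of $M$, and let $\mathrm{eigen}(M)=(\lambda_1(M)\ge\lambda_2(M)\ge\cdots\ge\lambda_n(M))$ be the list of its eigenvalues, with multiplicity. Two $n\times n$ real symmetric matrices $A$ and $B$ are called hypomorphic if, for every $i$, the matrix $B_i$ can be obtained from $A_i$ by applying one permutation (which may depend on $i$) simultaneously to the rows and the columns. Let $A$ and $B$ be $n\times n$ real symmetric matrices. (1) Suppose that $\mathrm{eigen}(A)=\mathrm{eigen}(B)$ and $\mathrm{eigen}(A_i)=\mathrm{eigen}(B_i)$ for all $i=1,\dots,n$. Let $\lambda$ be a simple eigenvalue of both $A$ and $B$ (that is, of multiplicity one), let $p=(p_1,\dots,p_n)^t$ be a unit vector in the $\lambda$-eigenspace of $A$, and let $q=(q_1,\dots,q_n)^t$ be a unit vector in the $\lambda$-eigenspace of $B$. Then $p_j^2=q_j^2$ for all $j=1,\dots,n$. (2) (Godsil–McKay) Suppose that $A$ and $B$ are hypomorphic. Let $\lambda$ be a simple eigenvalue of both $A$ and $B$, let $p$ be a unit vector in the $\lambda$-eigenspace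 of $A$, and let $q$ be a unit vector in the $\lambda$-eigenspace of $B$. Then $p_j^2=q_j^2$ for all $j=1,\dots,n$. -/

import Mathlib

namespace Reconstruction

/-- The matrix `A_i`, obtained from `A` by deleting the `i`-th row and the `i`-th column. -/
def deleteRowCol {n : ℕ} (A : Matrix (Fin n) (Fin n) ℝ) (i : Fin n) :
    Matrix {j : Fin n // j ≠ i} {j : Fin n // j ≠ i} ℝ :=
  A.submatrix Subtype.val Subtype.val

theorem deleteRowCol_isSymm {n : ℕ} {A : Matrix (Fin n) (Fin n) ℝ} (hA : A.IsSymm)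
    (i : Fin n) : (deleteRowCol A i).IsSymm :=
  hA.submatrix Subtype.val

theorem isHermitian_of_isSymm {ι : Type*} {M : Matrix ι ι ℝ} (hM : M.IsSymm) :
    M.IsHermitian := by
  rw [Matrix.IsHermitian, Matrix.conjTranspose_eq_transpose_of_trivial]
  exact hM

/-- `eigen M`: the eigenvalues of the real symmetric matrix `M`, repeated according to
multiplicity and listed in decreasing order. -/
noncomputable def eigen {ι : Type*} [Fintype ι] [DecidableEq ι] (M : Matrix ι ι ℝ)
    (hM : M.IsSymm) : Fin (Fintype.card ι) → ℝ :=
  (isHermitian_of_isSymm hM).eigenvalues₀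

/-- `eigenSpace M α`: the eigenspace of `M` for `α`, in Euclidean space. -/
noncomputable def eigenSpace {n : ℕ} (M : Matrix (Fin n) (Fin n) ℝ) (α : ℝ) :
    Submodule ℝ (EuclideanSpace ℝ (Fin n)) :=
  Module.End.eigenspace (Matrix.toEuclideanLin M) α

/-- `α` is a simple eigenvalue of `M`: a root of multiplicity one of the characteristic
polynomial. -/
def IsSimpleEigenvalue {n : ℕ} (M : Matrix (Fin n) (Fin n) ℝ) (α : ℝ) : Prop :=
  M.charpoly.rootMultiplicity α = 1

/-- `A` and `B` are hypomorphic: for each `i`, `B_i` is obtained from `A_i` by a simultaneous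
permutation (which may depend on `i`) of the rows and columns. -/
def Hypomorphic {n : ℕ} (A B : Matrix (Fin n) (Fin n) ℝ) : Prop :=
  ∀ i : Fin n, ∃ σ : Equiv.Perm {j : Fin n // j ≠ i},
    deleteRowCol B i = (deleteRowCol A i).submatrix σ σ

end Reconstruction

namespace Reconstruction

open Matrix Polynomial

/-! For a simple eigenvalue `α` with unit eigenvector `p`, `adj (α - A) = t p pᵀ` with `t ≠ 0`: its
columns lie in the line spanned by `p`, and it is symmetric. Its `i`-th diagonal entry is the
characteristic polynomial of `A_i` at `α`, so these values are `t * p i ^ 2`, and `∑ p i ^ 2 = 1`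
recovers `t` as their sum. Hence the squares depend only on the characteristic polynomials of the
`A_i`, which agree with those of the `B_i` under either assumption. -/

theorem adjugate_apply_self_eq_det_deleteRowCol {n : ℕ} (M : Matrix (Fin n) (Fin n) ℝ)
    (i : Fin n) : M.adjugate i i = (deleteRowCol M i).det := by
  cases n with
  | zero => exact i.elim0
  | succ m =>
    rw [adjugate_fin_succ_eq_det_submatrix, ← two_mul, pow_mul, neg_one_sq, one_pow, one_mul,
      ← det_submatrix_equiv_self (finSuccAboveEquiv i) (deleteRowCol M i)]
    rfl

theorem adjugate_scalar_sub_apply_self {n : ℕ} (A : Matrix (Fin n) (Fin n) ℝ) (α : ℝ)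
    (i : Fin n) :
    (scalar (Fin n) α - A).adjugate i i = (deleteRowCol A i).charpoly.eval α := by
  rw [adjugate_apply_self_eq_det_deleteRowCol, eval_charpoly]
  congr 1
  ext j k
  simp [deleteRowCol, diagonal_apply, Subtype.ext_iff]

/-- If `α` is a simple root of the characteristic polynomial, then an `α`-eigenvector of `A` is an
eigenvector of `adj (α - A)` for a nonzero eigenvalue. -/
theorem exists_adjugate_mulVec_eq_smul {ι : Type*} [Fintype ι] [DecidableEq ι]
    {A : Matrix ι ι ℝ} {α : ℝ} (hα : A.charpoly.rootMultiplicity α = 1) :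
    ∃ t : ℝ, t ≠ 0 ∧ ∀ p : ι → ℝ, A *ᵥ p = α • p →
      (scalar ι α - A).adjugate *ᵥ p = t • p := by
  obtain ⟨ψ, hψ, hndvd⟩ :=
    exists_eq_pow_rootMultiplicity_mul_and_not_dvd A.charpoly A.charpoly_monic.ne_zero α
  rw [hα, pow_one] at hψ
  -- With `A.charpoly = (X - C α) * ψ`, the eigenvalue is `ψ(α)`, nonzero because the root is
  -- simple.
  refine ⟨ψ.eval α, fun h => hndvd (dvd_iff_isRoot.mpr h), fun p hp => ?_⟩
  have hchar : charmatrix A *ᵥ (fun i => C (p i)) = (X - C α) • fun i => C (p i) := by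
    ext1 i
    have hi : ∑ j, A i j * p j = α * p i := congrFun hp i
    simp only [mulVec, dotProduct, charmatrix_apply, sub_mul, Finset.sum_sub_distrib,
      Pi.smul_apply, smul_eq_mul, ← C_mul, ← map_sum, hi]
    simp [diagonal_apply]
  -- Both sides agree after multiplication by `X - C α`, since `adj (X - A) * (X - A) = A.charpoly •
  -- 1`. The factor must be cancelled over `ℝ[X]`, before evaluation at `α` turns it into `0`.
  have hadj : (charmatrix A).adjugate *ᵥ (fun i => C (p i)) = ψ • fun i => C (p i) := by
    have h : (X - C α) • ((charmatrix A).adjugate *ᵥ fun i => C (p i)) =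
        (X - C α) • (ψ • fun i => C (p i)) := by
      rw [← mulVec_smul, ← hchar, mulVec_mulVec, adjugate_mul, smul_mulVec, one_mulVec,
        smul_smul, ← hψ]
      rfl
    exact smul_right_injective _ (X_sub_C_ne_zero α) h
  have hmap : (scalar ι α - A).adjugate = (charmatrix A).adjugate.map (eval α) := by
    have h := RingHom.map_adjugate (evalRingHom α) (charmatrix A)
    simp only [RingHom.mapMatrix_apply, coe_evalRingHom] at h
    rw [h]
    congr 1
    ext i j
    by_cases hij : i = j <;> simp [hij]
  ext1 i
  have hi := congrArg (eval α) (congrFun hadj i)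
  rw [hmap]
  simpa [mulVec, dotProduct, eval_finsetSum] using hi

theorem mem_eigenSpace_iff {n : ℕ} {A : Matrix (Fin n) (Fin n) ℝ} {α : ℝ}
    {p : EuclideanSpace ℝ (Fin n)} :
    p ∈ eigenSpace A α ↔ A *ᵥ p.ofLp = α • p.ofLp := by
  rw [eigenSpace, Module.End.mem_eigenspace_iff, ← (WithLp.ofLp_injective 2).eq_iff]
  simp [toEuclideanLin]

theorem finrank_eigenSpace_le_one {n : ℕ} {A : Matrix (Fin n) (Fin n) ℝ} {α : ℝ}
    (hα : IsSimpleEigenvalue A α) : Module.finrank ℝ (eigenSpace A α) ≤ 1 := by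
  have h := LinearMap.finrank_eigenspace_le (Matrix.toEuclideanLin A) α
  have hc : (Matrix.toEuclideanLin A).charpoly = A.charpoly := by
    rw [toEuclideanLin_eq_toLin_orthonormal, charpoly_toLin]
  rwa [hc, hα] at h

theorem sum_sq_eq_one {n : ℕ} {p : EuclideanSpace ℝ (Fin n)} (hp : ‖p‖ = 1) :
    ∑ i, p i ^ 2 = 1 := by
  rw [← EuclideanSpace.real_norm_sq_eq, hp, one_pow]

/-- The eigenvector-eigenvalue identity: the squared coordinates of a unit eigenvector for a simple
eigenvalue are proportional to the values of the characteristic polynomials of the principal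
submatrices. -/
theorem exists_eval_charpoly_deleteRowCol_eq {n : ℕ} {A : Matrix (Fin n) (Fin n) ℝ}
    (hA : A.IsSymm) {α : ℝ} (hα : IsSimpleEigenvalue A α) {p : EuclideanSpace ℝ (Fin n)}
    (hp : p ∈ eigenSpace A α) (hp1 : ‖p‖ = 1) :
    ∃ t : ℝ, t ≠ 0 ∧ ∀ i, (deleteRowCol A i).charpoly.eval α = t * p i ^ 2 := by
  obtain ⟨t, ht, hadj⟩ := exists_adjugate_mulVec_eq_smul hα
  refine ⟨t, ht, fun i => ?_⟩
  set M := scalar (Fin n) α - A with hM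
  have hdet : M.det = 0 := by
    rw [hM, ← eval_charpoly]
    exact (rootMultiplicity_pos A.charpoly_monic.ne_zero).mp (by rw [hα]; exact one_pos)
  have hsymm : M.adjugate.IsSymm := by
    refine IsSymm.adjugate (IsSymm.sub ?_ hA)
    simp [IsSymm]
  -- `M * adj M = det M • 1 = 0`, so each column of `adj M` is in the kernel of `M = α - A`.
  have hcol : WithLp.toLp 2 (M.adjugate.col i) ∈ eigenSpace A α := by
    rw [mem_eigenSpace_iff]
    have h : M *ᵥ M.adjugate.col i = 0 := by
      ext1 k
      have := congrFun (congrFun M.mul_adjugate k) i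
      simpa [hdet, mul_apply, mulVec, dotProduct] using this
    have h' : scalar (Fin n) α *ᵥ M.adjugate.col i - A *ᵥ M.adjugate.col i = 0 := by
      rw [← sub_mulVec, ← hM, h]
    rw [← sub_eq_zero.mp h']
    ext k
    rw [scalar_apply, mulVec_diagonal, Pi.smul_apply, smul_eq_mul]
  have hp0 : (⟨p, hp⟩ : eigenSpace A α) ≠ 0 := by
    intro h
    have : p = 0 := congrArg Subtype.val h
    simp [this] at hp1
  have hrank : Module.finrank ℝ (eigenSpace A α) = 1 :=
    le_antisymm (finrank_eigenSpace_le_one hα) (Module.finrank_pos_iff_exists_ne_zero.mpr ⟨_, hp0⟩)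
  obtain ⟨c, hc⟩ := exists_smul_eq_of_finrank_eq_one hrank hp0 ⟨_, hcol⟩
  have hentry : ∀ k, M.adjugate k i = c * p k := fun k =>
    (congrArg (fun v : eigenSpace A α => (v : EuclideanSpace ℝ (Fin n)) k) hc).symm
  -- By symmetry row `i` of `adj M` is also `c • p`; pairing it with the unit vector `p` gives `c`,
  -- while `adj M *ᵥ p = t • p` gives `t * p i`.
  have hci : c = t * p i := by
    have h := congrFun (hadj p.ofLp (mem_eigenSpace_iff.mp hp)) i
    have h' : ∑ k, M.adjugate i k * p k = t * p i := h
    rw [← h', ← mul_one c, ← sum_sq_eq_one hp1, Finset.mul_sum]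
    refine Finset.sum_congr rfl fun k _ => ?_
    rw [← hsymm.apply, hentry]
    ring
  rw [← adjugate_scalar_sub_apply_self, ← hM, hentry, hci]
  ring

theorem sq_eq_sq_of_charpoly_deleteRowCol_eq {n : ℕ} {A B : Matrix (Fin n) (Fin n) ℝ}
    (hA : A.IsSymm) (hB : B.IsSymm)
    (h : ∀ i, (deleteRowCol A i).charpoly = (deleteRowCol B i).charpoly) {α : ℝ}
    (hαA : IsSimpleEigenvalue A α) (hαB : IsSimpleEigenvalue B α)
    {p q : EuclideanSpace ℝ (Fin n)} (hp : p ∈ eigenSpace A α) (hq : q ∈ eigenSpace B α)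
    (hp1 : ‖p‖ = 1) (hq1 : ‖q‖ = 1) (j : Fin n) : p j ^ 2 = q j ^ 2 := by
  obtain ⟨s, hs, hsp⟩ := exists_eval_charpoly_deleteRowCol_eq hA hαA hp hp1
  obtain ⟨t, -, htq⟩ := exists_eval_charpoly_deleteRowCol_eq hB hαB hq hq1
  have hst : ∀ i, s * p i ^ 2 = t * q i ^ 2 := fun i => by rw [← hsp, ← htq, h]
  -- Summing over all coordinates identifies the two constants, as both vectors have norm one.
  have heq : s = t := by
    calc s = ∑ i, s * p i ^ 2 := by rw [← Finset.mul_sum, sum_sq_eq_one hp1, mul_one]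
      _ = ∑ i, t * q i ^ 2 := Finset.sum_congr rfl fun i _ => hst i
      _ = t := by rw [← Finset.mul_sum, sum_sq_eq_one hq1, mul_one]
  exact mul_left_cancel₀ hs ((hst j).trans (by rw [heq]))

theorem charpoly_eq_of_eigen_eq {ι : Type*} [Fintype ι] [DecidableEq ι] {M N : Matrix ι ι ℝ}
    {hM : M.IsSymm} {hN : N.IsSymm} (h : eigen M hM = eigen N hN) :
    M.charpoly = N.charpoly := by
  rw [← (isHermitian_of_isSymm hM).eigenvalues_eq_eigenvalues_iff (isHermitian_of_isSymm hN)]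
  unfold eigen at h
  -- `eigenvalues` is `eigenvalues₀` reindexed by a bijection that depends only on the index type.
  unfold IsHermitian.eigenvalues
  rw [h]

theorem Hypomorphic.charpoly_deleteRowCol_eq {n : ℕ} {A B : Matrix (Fin n) (Fin n) ℝ}
    (h : Hypomorphic A B) (i : Fin n) :
    (deleteRowCol A i).charpoly = (deleteRowCol B i).charpoly := by
  obtain ⟨σ, hσ⟩ := h i
  rw [hσ]
  exact (charpoly_reindex σ.symm _).symm

end Reconstruction

theorem mainTheorem2 {n : ℕ} (A B : Matrix (Fin n) (Fin n) ℝ) (hA : A.IsSymm) (hB : B.IsSymm) :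
    ((Reconstruction.eigen A hA = Reconstruction.eigen B hB ∧
        ∀ i : Fin n,
          Reconstruction.eigen (Reconstruction.deleteRowCol A i)
              (Reconstruction.deleteRowCol_isSymm hA i) =
            Reconstruction.eigen (Reconstruction.deleteRowCol B i)
              (Reconstruction.deleteRowCol_isSymm hB i)) →
      ∀ α : ℝ, Reconstruction.IsSimpleEigenvalue A α → Reconstruction.IsSimpleEigenvalue B α →
        ∀ p ∈ Reconstruction.eigenSpace A α, ∀ q ∈ Reconstruction.eigenSpace B α,
          ‖p‖ = 1 → ‖q‖ = 1 → ∀ j : Fin n, p j ^ 2 = q j ^ 2) ∧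
    (Reconstruction.Hypomorphic A B →
      ∀ α : ℝ, Reconstruction.IsSimpleEigenvalue A α → Reconstruction.IsSimpleEigenvalue B α →
        ∀ p ∈ Reconstruction.eigenSpace A α, ∀ q ∈ Reconstruction.eigenSpace B α,
          ‖p‖ = 1 → ‖q‖ = 1 → ∀ j : Fin n, p j ^ 2 = q j ^ 2) := by
  refine ⟨fun h α hαA hαB p hp q hq hp1 hq1 => ?_, fun h α hαA hαB p hp q hq hp1 hq1 => ?_⟩
  · exact Reconstruction.sq_eq_sq_of_charpoly_deleteRowCol_eq hA hB
      (fun i => Reconstruction.charpoly_eq_of_eigen_eq (h.2 i)) hαA hαB hp hq hp1 hq1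
  · exact Reconstruction.sq_eq_sq_of_charpoly_deleteRowCol_eq hA hB
      h.charpoly_deleteRowCol_eq hαA hαB hp hq hp1 hq1
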